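/- **Model.** Let $N$ (nodes), $T$ (time points), $R_S, R_D$ (latent dimensions) and $K$ (groups of time points) be natural numbers. A parameter is $\mathcal T=(Z;\{U^{(k)}\}_{k=1}^K;\{V^{(t)}\}_{t=1}^T;\mathcal G)$ with $Z\in\mathbb R^{N\times R_S}$, $U^{(k)}\in\mathbb R^{N\times R_D}$, diagonal $V^{(t)}\in\mathbb R^{R_D\times R_D}$ and labels $\mathcal G=(g_1,\dots,g_T)\in\{1,\dots,K\}^T$. Its logit tensor $\Theta=[\Theta^{(1)};\dots;\Theta^{(T)}]$ has the slices $\Theta^{(t)}=S+D^{(t)}$, where $S=ZZ^\top$ and $D^{(t)}=U^{(g_t)}V^{(t)}U^{(g_t)\top}$. For $\tau_1,\tau_2>0$ consider the conditions (C1) $\|\Theta^{(t)}\|_{\max}\le\tau_1$ and $\|V^{(t)}\|_{\max}\le\tau_2$ for all $t$ (largest absolute entry); (C2) $\sum_{t=1}^T D^{(t)}=0$. Let the true parameter $\mathcal T^*$ satisfy (C1) and (C2). One observes random symmetric matrices $A^{(1)},\dots,A^{(T)}\in\{0,1\}^{N\times N}$ whose entries $A^{(t)}_{ij}$, $i\le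 j$, $t\le T$, are independent, where $A^{(t)}_{ij}$ is Bernoulli with parameter $P^{(t)}_{ij}$, $\operatorname{logit}P^{(t)}_{ij}=\Theta^{*(t)}_{ij}$, for all $i\neq j$. The diagonal entries are treated in (a) and (b). An oracle estimator $\widehat{\mathcal T}^{or}$ is any minimizer of the negative log-likelihood $$\ell_1(\mathcal T)=-\sum_{t=1}^T\sum_{i=1}^N\sum_{j=1}^N\Big[A^{(t)}_{ij}\Theta^{(t)}_{ij}-\log\{1+\exp(\Theta^{(t)}_{ij})\}\Big]$$ over all parameters $\mathcal T$ (including the labels) that satisfy (C1) and (C2) and $U^{(k)}_{i\cdot}=0$ whenever $U^{(k)*}_{i\cdot}=0$. Let $\widehat\Theta^{or}$ be its logit tensor, and $\Theta^*$ that of $\mathcal T^*$. **Theorem 1.** There are universal constants $c_1,c_2>0$ and, for each $\tau_1>0$, constants $C_1,C_2>0$ depending only on $\tau_1$, such that for all $\tau_2>0$, $N,T,R_S,R_D,K$ and all $\mathcal T^*$ as above the following holds. (a) If the diagonal entries follow the model as well, i.e. $A^{(t)}_{ii}$ is Bernoulli with $\operatorname{logit}P^{(t)}_{ii}=\Theta^{*(t)}_{ii}$,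 then with probability at least $1-T e^{-c_1N}-e^{-c_2(2N+T)}$ every oracle estimator satisfies $$\|\widehat\Theta^{or}-\Theta^*\|_F^2\le C_1NR_S+C_2K^2R_D^2(2N+T).$$ (b) If instead there are no self-loops, i.e. $A^{(t)}_{ii}=0$ for all $i,t$, then with probability at least $1-T e^{-c_1N}-e^{-c_2(2N+T)}$ every oracle estimator satisfies $$\|\widehat\Theta^{or}-\Theta^*\|_F^2\le C_1(N+T)R_S+C_2K^2R_D^2(2N+T);$$ in particular, if $T\le\delta N$ the bound of (a) holds with $C_1(1+\delta)$ in place of $C_1$. -/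

import Mathlib

open MeasureTheory ProbabilityTheory

/-- Parameters `(Z, (U⁽ᵏ⁾), (V⁽ᵗ⁾), 𝒢)` of the latent space model for `N` nodes, `T` time points,
shared dimension `RS`, time-varying dimension `RD` and `K` groups of time points.
`v t` lists the diagonal of the diagonal matrix `V⁽ᵗ⁾`, and `g t` is the group of time `t`. -/
structure STANEParams (N T RS RD K : ℕ) where
  Z : Matrix (Fin N) (Fin RS) ℝ
  U : Fin K → Matrix (Fin N) (Fin RD) ℝ
  v : Fin T → Fin RD → ℝ
  g : Fin T → Fin K

namespace STANEParams

variable {N T RS RD K : ℕ}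

/-- The diagonal matrix `V⁽ᵗ⁾`. -/
def V (p : STANEParams N T RS RD K) (t : Fin T) : Matrix (Fin RD) (Fin RD) ℝ :=
  Matrix.diagonal (p.v t)

/-- The shared component `S = Z Zᵀ`. -/
def S (p : STANEParams N T RS RD K) : Matrix (Fin N) (Fin N) ℝ :=
  p.Z * p.Z.transpose

/-- The time-varying component `D⁽ᵗ⁾ = U⁽ᵍᵗ⁾ V⁽ᵗ⁾ U⁽ᵍᵗ⁾ᵀ`. -/
def D (p : STANEParams N T RS RD K) (t : Fin T) : Matrix (Fin N) (Fin N) ℝ :=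
  p.U (p.g t) * p.V t * (p.U (p.g t)).transpose

/-- The logit tensor, `Θ⁽ᵗ⁾ = S + D⁽ᵗ⁾`. -/
def Theta (p : STANEParams N T RS RD K) (t : Fin T) : Matrix (Fin N) (Fin N) ℝ :=
  p.S + p.D t

/-- Bounded entries: `‖Θ⁽ᵗ⁾‖_max ≤ τ₁` and `‖V⁽ᵗ⁾‖_max ≤ τ₂` for all `t`. -/
def Bounded (τ₁ τ₂ : ℝ) (p : STANEParams N T RS RD K) : Prop :=
  ∀ t, (∀ i j, |p.Theta t i j| ≤ τ₁) ∧ (∀ r s, |p.V t r s| ≤ τ₂)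

/-- Centering: `∑ₜ D⁽ᵗ⁾ = 0`. -/
def Centered (p : STANEParams N T RS RD K) : Prop :=
  ∑ t, p.D t = 0

/-- The support of `U⁽ᵏ⁾`: the set of its nonzero rows. -/
def rowSupport (p : STANEParams N T RS RD K) (k : Fin K) : Set (Fin N) :=
  {i | p.U k i ≠ 0}

/-- The negative log-likelihood `ℓ₁` of the parameters for the adjacency tensor `A`. -/
noncomputable def negLogLik (A : Fin T → Matrix (Fin N) (Fin N) ℝ)
    (p : STANEParams N T RS RD K) : ℝ :=
  -∑ t, ∑ i, ∑ j, (A t i j * p.Theta t i j - Real.log (1 + Real.exp (p.Theta t i j)))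

/-- The parameter sets over which the oracle estimator is computed: those satisfying the
boundedness and centering conditions whose `U⁽ᵏ⁾` vanish on every row outside the support of
the true `U⁽ᵏ⁾`. -/
def oracleSet (τ₁ τ₂ : ℝ) (truth : STANEParams N T RS RD K) : Set (STANEParams N T RS RD K) :=
  {p | p.Bounded τ₁ τ₂ ∧ p.Centered ∧ ∀ k, ∀ i ∉ truth.rowSupport k, p.U k i = 0}

/-- `p` is an oracle estimator for the data `A`: a minimizer of `ℓ₁` over the oracle set. -/
def IsOracleEstimator (τ₁ τ₂ : ℝ) (truth : STANEParams N T RS RD K)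
    (A : Fin T → Matrix (Fin N) (Fin N) ℝ) (p : STANEParams N T RS RD K) : Prop :=
  p ∈ oracleSet τ₁ τ₂ truth ∧ IsMinOn (negLogLik A) (oracleSet τ₁ τ₂ truth) p

/-- The squared Frobenius distance `‖Θ(p) - Θ(q)‖_F²` of the logit tensors. -/
def sqDist (p q : STANEParams N T RS RD K) : ℝ :=
  ∑ t, ∑ i, ∑ j, (p.Theta t i j - q.Theta t i j) ^ 2

end STANEParams

/-- `A` is a random dynamic undirected network with logits `Θ`: its entries are `0` or `1`, each
slice is symmetric, the entries on and above the diagonals of all slices are jointly independent,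
and each off-diagonal entry is Bernoulli with parameter `P = 1 / (1 + exp (-Θ))`, i.e.
`logit P = Θ`. The law of the diagonal entries is left to `BernoulliLoops` or `NoLoops`. -/
structure IsRandomNetwork {N T : ℕ} {Ω : Type*} [MeasurableSpace Ω] (μ : Measure Ω)
    (Θ : Fin T → Matrix (Fin N) (Fin N) ℝ) (A : Ω → Fin T → Matrix (Fin N) (Fin N) ℝ) : Prop where
  measurable : ∀ t i j, Measurable fun ω => A ω t i j
  zero_or_one : ∀ ω t i j, A ω t i j = 0 ∨ A ω t i j = 1
  symm : ∀ ω t i j, A ω t i j = A ω t j i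
  indep : iIndepFun (fun (e : {e : Fin T × Fin N × Fin N // e.2.1 ≤ e.2.2}) (ω : Ω) =>
    A ω e.1.1 e.1.2.1 e.1.2.2) μ
  bernoulli : ∀ t i j, i ≠ j → μ.real {ω | A ω t i j = 1} = Real.sigmoid (Θ t i j)

/-- The diagonal entries are Bernoulli with `logit P = Θ`, too. -/
def BernoulliLoops {N T : ℕ} {Ω : Type*} [MeasurableSpace Ω] (μ : Measure Ω)
    (Θ : Fin T → Matrix (Fin N) (Fin N) ℝ) (A : Ω → Fin T → Matrix (Fin N) (Fin N) ℝ) : Prop :=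
  ∀ t i, μ.real {ω | A ω t i i = 1} = Real.sigmoid (Θ t i i)

/-- There are no self-loops. -/
def NoLoops {N T : ℕ} {Ω : Type*} (A : Ω → Fin T → Matrix (Fin N) (Fin N) ℝ) : Prop :=
  ∀ ω t i, A ω t i i = 0

/-! A minimizer is at least as likely as the truth. On `[-τ₁, τ₁]` the log-likelihood is strongly
concave with modulus `sigmoid (-τ₁) ^ 2`, so the squared error is at most a constant times the
pairing of `E = A - sigmoid Θ*` with the error (`sqDist_le_of_negLogLik_le`). Centering makes the
shared error ΔS and the dynamic error ΔD orthogonal (`sqDist_eq`), and the pairing splits into `⟨∑ₜ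
Eₜ, ΔS⟩ + ⟨E, ΔD⟩`. The columns of ΔS lie in a space of dimension `2 RS`. The rows and columns of
all slices of ΔD lie in one space of dimension `2 K RD`, whatever the labels. Each pairing is thus a
spectral norm of the noise, times `√(2 RS)` or `2 K RD`, times a Frobenius norm. No union over
labels or parameters is needed: only norms of the noise are random. Nets and Hoeffding's inequality
bound these norms by multiples of `√(N T)` and `√(2N + T)`. The noise is centred at the true mean of
`A`; the remaining bias is diagonal, vanishes with Bernoulli loops and has entries of size at most 1
without loops. It costs `√T` in the trilinear norm, which is absorbed, and `T` in the bilinear norm,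
whence the extra `T RS`. -/

/-! ### Strong convexity of the logistic loss. -/

section Convexity

theorem hasDerivAt_log_one_add_exp (x : ℝ) :
    HasDerivAt (fun x => Real.log (1 + Real.exp x)) (Real.sigmoid x) x := by
  have h := ((Real.hasDerivAt_exp x).const_add 1).log (by positivity)
  convert h using 1
  rw [Real.sigmoid_def, Real.exp_neg]
  have := Real.exp_pos x
  field_simp
  ring

/-- On `[-τ, τ]` the function `x ↦ log (1 + exp x)` is strongly convex with modulus
`sigmoid (-τ) ^ 2`. -/
theorem log_one_add_exp_strong_convexity {τ x y : ℝ} (hx : |x| ≤ τ) (hy : |y| ≤ τ) :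
    Real.log (1 + Real.exp x) + Real.sigmoid x * (y - x)
        + Real.sigmoid (-τ) ^ 2 / 2 * (y - x) ^ 2
      ≤ Real.log (1 + Real.exp y) := by
  set α := Real.sigmoid (-τ) ^ 2 with hα
  have hd : ∀ z, HasDerivAt (fun z => Real.log (1 + Real.exp z) - α / 2 * z ^ 2)
      (Real.sigmoid z - α * z) z := by
    intro z
    have h := (hasDerivAt_log_one_add_exp z).sub ((hasDerivAt_pow 2 z).const_mul (α / 2))
    refine h.congr_deriv ?_
    push_cast
    ring
  have hd2 : ∀ z, HasDerivAt (fun z => Real.sigmoid z - α * z)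
      (Real.sigmoid z * (1 - Real.sigmoid z) - α) z := by
    intro z
    have h := (Real.hasDerivAt_sigmoid z).sub ((hasDerivAt_id z).const_mul α)
    exact h.congr_deriv (by ring)
  -- The derivative of the sigmoid is `sigmoid z * sigmoid (-z)`, and both factors are at least
  -- `sigmoid (-τ)` when `|z| ≤ τ`.
  have hmono : MonotoneOn (fun z => Real.sigmoid z - α * z) (Set.Icc (-τ) τ) := by
    refine monotoneOn_of_deriv_nonneg (convex_Icc _ _)
      (fun z _ => (hd2 z).continuousAt.continuousWithinAt)
      (fun z _ => (hd2 z).differentiableAt.differentiableWithinAt) ?_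
    intro z hz
    rw [interior_Icc] at hz
    rw [(hd2 z).deriv, hα, ← Real.sigmoid_neg]
    have h1 : Real.sigmoid (-τ) ≤ Real.sigmoid z := Real.sigmoid_le hz.1.le
    have h2 : Real.sigmoid (-τ) ≤ Real.sigmoid (-z) := Real.sigmoid_le (by linarith [hz.2])
    have := mul_le_mul h1 h2 (Real.sigmoid_nonneg _) (Real.sigmoid_nonneg _)
    nlinarith
  have hconv : ConvexOn ℝ (Set.Icc (-τ) τ) (fun z => Real.log (1 + Real.exp z) - α / 2 * z ^ 2) := by
    refine MonotoneOn.convexOn_of_deriv (convex_Icc _ _)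
      (fun z _ => (hd z).continuousAt.continuousWithinAt)
      (fun z _ => (hd z).differentiableAt.differentiableWithinAt) ?_
    rw [show deriv (fun z => Real.log (1 + Real.exp z) - α / 2 * z ^ 2)
      = fun z => Real.sigmoid z - α * z from funext fun z => (hd z).deriv]
    exact hmono.mono interior_subset
  have hx' := Set.mem_Icc.2 (abs_le.1 hx)
  have hy' := Set.mem_Icc.2 (abs_le.1 hy)
  have key : (Real.sigmoid x - α * x) * (y - x)
      ≤ (Real.log (1 + Real.exp y) - α / 2 * y ^ 2)
        - (Real.log (1 + Real.exp x) - α / 2 * x ^ 2) := by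
    rcases lt_trichotomy x y with h | h | h
    · have := hconv.le_slope_of_hasDerivAt hx' hy' h (hd x)
      rw [slope_def_field, le_div_iff₀ (by linarith)] at this
      exact this
    · subst h; simp
    · have := hconv.slope_le_of_hasDerivAt hy' hx' h (hd x)
      rw [slope_def_field, div_le_iff₀ (by linarith)] at this
      linarith
  nlinarith

end Convexity

/-! ### Nets of unit balls and norms of multilinear forms. -/

section Nets

/-- Every finite-dimensional space has a `1/2`-net of its unit ball of cardinality at most
`5 ^ dim`. -/
theorem exists_half_net (E : Type*) [NormedAddCommGroup E] [NormedSpace ℝ E]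
    [FiniteDimensional ℝ E] :
    ∃ s : Finset E, s.card ≤ 5 ^ Module.finrank ℝ E ∧ (∀ x ∈ s, ‖x‖ ≤ 1) ∧
      ∀ x : E, ‖x‖ ≤ 1 → ∃ y ∈ s, ‖x - y‖ ≤ 1 / 2 := by
  classical
  -- A 1-separated set of maximal size in the ball of radius 2, the scale of
  -- `Besicovitch.card_le_of_separated`, is a 1-net there; halving it gives the net.
  let P : ℕ → Prop := fun n => ∃ s : Finset E, s.card = n ∧ (∀ c ∈ s, ‖c‖ ≤ 2) ∧
    ∀ c ∈ s, ∀ d ∈ s, c ≠ d → 1 ≤ ‖c - d‖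
  have h0 : P 0 := ⟨∅, by simp⟩
  obtain ⟨s, hcard, hs2, hsep⟩ := Nat.findGreatest_spec (P := P)
    (Nat.zero_le (5 ^ Module.finrank ℝ E)) h0
  have hmax : ∀ n, P n → n ≤ s.card := by
    rintro n ⟨s', rfl, h2, hsep'⟩
    rw [hcard]
    exact Nat.le_findGreatest (Besicovitch.card_le_of_separated s' h2 hsep')
      ⟨s', rfl, h2, hsep'⟩
  refine ⟨s.image fun c => (1 / 2 : ℝ) • c, ?_, ?_, ?_⟩
  · exact Finset.card_image_le.trans (Besicovitch.card_le_of_separated s hs2 hsep)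
  · intro x hx
    obtain ⟨c, hc, rfl⟩ := Finset.mem_image.1 hx
    rw [norm_smul]
    have := hs2 c hc
    norm_num
    linarith
  · intro x hx
    by_contra! hcon
    have hcon' : ∀ c ∈ s, 1 < ‖(2 : ℝ) • x - c‖ := by
      intro c hc
      have h1 := hcon _ (Finset.mem_image_of_mem _ hc)
      have h2 : (2 : ℝ) • x - c = (2 : ℝ) • (x - (1 / 2 : ℝ) • c) := by
        rw [smul_sub, smul_smul]; norm_num
      rw [h2, norm_smul]
      norm_num
      norm_num at h1
      linarith
    have hnot : (2 : ℝ) • x ∉ s := fun h => by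
      have := hcon' _ h
      simp at this
      linarith
    have := hmax (insert ((2 : ℝ) • x) s).card ⟨_, rfl, ?_, ?_⟩
    · rw [Finset.card_insert_of_notMem hnot] at this
      omega
    · intro c hc
      rcases Finset.mem_insert.1 hc with rfl | hc
      · rw [norm_smul]; norm_num; linarith
      · exact hs2 c hc
    · intro c hc d hd hcd
      rcases Finset.mem_insert.1 hc with rfl | hc <;> rcases Finset.mem_insert.1 hd with rfl | hd
      · exact absurd rfl hcd
      · exact (hcon' d hd).le
      · rw [norm_sub_rev]; exact (hcon' c hc).le
      · exact hsep c hc d hd hcd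

variable {ι κ ν : Type*} [Fintype ι] [Fintype κ] [Fintype ν]

/-- `s` is a `1/2`-net of the unit ball. -/
def IsHalfNet {E : Type*} [NormedAddCommGroup E] (s : Finset E) : Prop :=
  ∀ x : E, ‖x‖ ≤ 1 → ∃ y ∈ s, ‖x - y‖ ≤ 1 / 2

/-- For `y` in the net near `a / ‖a‖`, `‖a‖ = ⟨a, y⟩ + ⟨a, a / ‖a‖ - y⟩ ≤ B + ‖a‖ / 2`, so each slot
moved from the net to all vectors costs a factor 2. -/
theorem IsHalfNet.inner_le {E : Type*} [NormedAddCommGroup E] [InnerProductSpace ℝ E]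
    {s : Finset E} (hs : IsHalfNet s) {a : E} {B : ℝ} (h : ∀ x ∈ s, inner ℝ a x ≤ B) (v : E) :
    inner ℝ a v ≤ 2 * B * ‖v‖ := by
  suffices ha : ‖a‖ ≤ 2 * B from
    (real_inner_le_norm a v).trans (mul_le_mul_of_nonneg_right ha (norm_nonneg v))
  rcases eq_or_ne a 0 with rfl | hne
  · obtain ⟨y, hy, -⟩ := hs 0 (by simp)
    have := h y hy
    simp at this ⊢
    linarith
  · have hpos : 0 < ‖a‖ := norm_pos_iff.2 hne
    obtain ⟨y, hy, hle⟩ := hs (‖a‖⁻¹ • a) (by rw [norm_smul]; simp [hpos.ne'])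
    have h1 := h y hy
    have h2 : inner ℝ a (‖a‖⁻¹ • a) = ‖a‖ := by
      rw [real_inner_smul_right, real_inner_self_eq_norm_sq]
      field_simp
    have h3 := real_inner_le_norm a (‖a‖⁻¹ • a - y)
    rw [inner_sub_right, h2] at h3
    nlinarith

theorem IsHalfNet.linear_le {s : Finset (EuclideanSpace ℝ ι)} (hs : IsHalfNet s) {a : ι → ℝ}
    {B : ℝ} (h : ∀ x ∈ s, ∑ i, a i * x i ≤ B) (v : EuclideanSpace ℝ ι) :
    ∑ i, a i * v i ≤ 2 * B * ‖v‖ := by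
  have key : ∀ x : EuclideanSpace ℝ ι, inner ℝ (WithLp.toLp 2 a) x = ∑ i, a i * x i := by
    intro x
    simp [PiLp.inner_apply, mul_comm]
  rw [← key]
  exact hs.inner_le (fun x hx => (key x).trans_le (h x hx)) v

theorem IsHalfNet.bilinear_le {s : Finset (EuclideanSpace ℝ ι)} (hs : IsHalfNet s)
    {s' : Finset (EuclideanSpace ℝ κ)} (hs' : IsHalfNet s') {M : ι → κ → ℝ}
    {B : ℝ} (h : ∀ x ∈ s, ∀ y ∈ s', ∑ i, ∑ j, M i j * x i * y j ≤ B)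
    (u : EuclideanSpace ℝ ι) (v : EuclideanSpace ℝ κ) :
    ∑ i, ∑ j, M i j * u i * v j ≤ 4 * B * ‖u‖ * ‖v‖ := by
  have h1 : ∀ x ∈ s, ∑ i, (∑ j, M i j * v j) * x i ≤ 2 * B * ‖v‖ := by
    intro x hx
    have := hs'.linear_le (a := fun j => ∑ i, M i j * x i) (B := B) (fun y hy => by
      refine le_trans (le_of_eq ?_) (h x hx y hy)
      simp_rw [Finset.sum_mul]
      exact Finset.sum_comm) v
    refine le_trans (le_of_eq ?_) this
    simp_rw [Finset.sum_mul]
    rw [Finset.sum_comm]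
    exact Finset.sum_congr rfl fun _ _ => Finset.sum_congr rfl fun _ _ => by ring
  have h2 := hs.linear_le h1 u
  refine le_trans (le_of_eq ?_) (h2.trans (le_of_eq (by ring)))
  simp_rw [Finset.sum_mul]
  exact Finset.sum_congr rfl fun _ _ => Finset.sum_congr rfl fun _ _ => by ring

theorem sum_sum_sum_rotate (f : ι → κ → ν → ℝ) :
    ∑ i, ∑ j, ∑ t, f i j t = ∑ t, ∑ i, ∑ j, f i j t := by
  simp_rw [Finset.sum_comm (s := (Finset.univ : Finset κ)) (t := (Finset.univ : Finset ν))]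
  exact Finset.sum_comm

theorem IsHalfNet.trilinear_le {s : Finset (EuclideanSpace ℝ ι)} (hs : IsHalfNet s)
    {s' : Finset (EuclideanSpace ℝ κ)} (hs' : IsHalfNet s')
    {r : Finset (EuclideanSpace ℝ ν)} (hr : IsHalfNet r) {M : ν → ι → κ → ℝ}
    {B : ℝ} (h : ∀ x ∈ s, ∀ y ∈ s', ∀ w ∈ r, ∑ t, ∑ i, ∑ j, M t i j * x i * y j * w t ≤ B)
    (u : EuclideanSpace ℝ ι) (v : EuclideanSpace ℝ κ) (w : EuclideanSpace ℝ ν) :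
    ∑ t, ∑ i, ∑ j, M t i j * u i * v j * w t ≤ 8 * B * ‖u‖ * ‖v‖ * ‖w‖ := by
  have h1 : ∀ w ∈ r, ∑ t, (∑ i, ∑ j, M t i j * u i * v j) * w t ≤ 4 * B * ‖u‖ * ‖v‖ := by
    intro w hw
    have := hs.bilinear_le hs' (M := fun i j => ∑ t, M t i j * w t) (B := B) (fun x hx y hy => by
      refine le_trans (le_of_eq ?_) (h x hx y hy w hw)
      simp_rw [Finset.sum_mul]
      rw [sum_sum_sum_rotate]
      exact Finset.sum_congr rfl fun _ _ => Finset.sum_congr rfl fun _ _ =>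
        Finset.sum_congr rfl fun _ _ => by ring) u v
    refine le_trans (le_of_eq ?_) this
    simp_rw [Finset.sum_mul]
    refine Eq.trans ?_ (sum_sum_sum_rotate _).symm
    exact Finset.sum_congr rfl fun _ _ => Finset.sum_congr rfl fun _ _ =>
      Finset.sum_congr rfl fun _ _ => by ring
  have h2 := hr.linear_le h1 w
  refine le_trans (le_of_eq ?_) (h2.trans (le_of_eq (by ring)))
  simp_rw [Finset.sum_mul]

end Nets

/-! ### Pairings with low-rank matrices and tensors. -/

section LowRank

variable {ι κ ν : Type*} [Fintype ι] [Fintype κ] [Fintype ν]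

/-- A pairing with a family of vectors in a subspace of dimension `r` costs a factor `√r` over
the pairings with the coordinates of the family along unit vectors. -/
theorem sum_mul_le_sqrt_finrank (W : Submodule ℝ (EuclideanSpace ℝ ι)) (M : ι → κ → ℝ)
    (X : κ → EuclideanSpace ℝ ι) (hX : ∀ j, X j ∈ W) {B : ℝ} (hB : 0 ≤ B)
    (h : ∀ u : EuclideanSpace ℝ ι, ‖u‖ = 1 →
      ∑ i, ∑ j, M i j * u i * inner ℝ u (X j) ≤ B * √(∑ j, inner ℝ u (X j) ^ 2)) :
    ∑ i, ∑ j, M i j * X j i ≤ B * √(Module.finrank ℝ W) * √(∑ j, ‖X j‖ ^ 2) := by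
  let b := stdOrthonormalBasis ℝ W
  have hexp : ∀ j i, X j i = ∑ a, (b a : EuclideanSpace ℝ ι) i *
      inner ℝ (b a : EuclideanSpace ℝ ι) (X j) := by
    intro j i
    have h1 := congrArg (fun x : W => (x : EuclideanSpace ℝ ι) i) (b.sum_repr' ⟨X j, hX j⟩)
    simp only [Submodule.coe_sum, Submodule.coe_smul, Submodule.coe_inner] at h1
    rw [← h1]
    simp [mul_comm]
  have hnorm : ∀ j, ∑ a, inner ℝ (b a : EuclideanSpace ℝ ι) (X j) ^ 2 = ‖X j‖ ^ 2 := by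
    intro j
    have h1 := b.sum_sq_norm_inner_right ⟨X j, hX j⟩
    simpa [Submodule.coe_inner] using h1
  have hsplit : ∑ i, ∑ j, M i j * X j i = ∑ a, ∑ i, ∑ j,
      M i j * (b a : EuclideanSpace ℝ ι) i * inner ℝ (b a : EuclideanSpace ℝ ι) (X j) := by
    rw [← sum_sum_sum_rotate]
    refine Finset.sum_congr rfl fun i _ => Finset.sum_congr rfl fun j _ => ?_
    rw [hexp j i, Finset.mul_sum]
    exact Finset.sum_congr rfl fun a _ => by ring
  -- Cauchy–Schwarz against the constant 1 over the orthonormal basis: this is where `√r` arises.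
  have hcs := Real.sum_sqrt_mul_sqrt_le (Finset.univ : Finset (Fin (Module.finrank ℝ W)))
    (f := fun _ => 1) (g := fun a => ∑ j, inner ℝ (b a : EuclideanSpace ℝ ι) (X j) ^ 2)
    (fun _ => zero_le_one) (fun a => Finset.sum_nonneg fun j _ => sq_nonneg _)
  simp only [Real.sqrt_one, one_mul, Finset.sum_const, Finset.card_univ, Fintype.card_fin,
    nsmul_eq_mul, mul_one] at hcs
  rw [Finset.sum_comm] at hcs
  simp_rw [hnorm] at hcs
  calc ∑ i, ∑ j, M i j * X j i
      ≤ ∑ a, B * √(∑ j, inner ℝ (b a : EuclideanSpace ℝ ι) (X j) ^ 2) := by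
        rw [hsplit]
        exact Finset.sum_le_sum fun a _ => h _ (b.orthonormal.1 a)
    _ ≤ _ := by
        rw [← Finset.mul_sum, mul_assoc]
        exact mul_le_mul_of_nonneg_left hcs hB

theorem sum_mul_le_of_bilinear_le (W : Submodule ℝ (EuclideanSpace ℝ ι)) (M X : ι → κ → ℝ)
    (hX : ∀ j, WithLp.toLp 2 (fun i => X i j) ∈ W) {B : ℝ} (hB : 0 ≤ B)
    (h : ∀ (u : EuclideanSpace ℝ ι) (v : EuclideanSpace ℝ κ),
      ∑ i, ∑ j, M i j * u i * v j ≤ B * ‖u‖ * ‖v‖) :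
    ∑ i, ∑ j, M i j * X i j ≤ B * √(Module.finrank ℝ W) * √(∑ i, ∑ j, X i j ^ 2) := by
  have := sum_mul_le_sqrt_finrank W M (fun j => WithLp.toLp 2 fun i => X i j) hX hB
    (fun u hu => by
      have := h u (WithLp.toLp 2 fun j => inner ℝ u (WithLp.toLp 2 fun i => X i j))
      rw [hu, mul_one, EuclideanSpace.norm_eq] at this
      simpa using this)
  refine this.trans (le_of_eq ?_)
  congr 2
  rw [Finset.sum_comm]
  simp [EuclideanSpace.norm_sq_eq]

/-- Flatten the last two modes into one and expand along `W`; contracting with a unit vector `u`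
leaves a matrix with columns in `W'`, to which the bilinear case applies. The third mode needs no
rank bound and costs no factor. -/
theorem sum_mul_le_of_trilinear_le (W : Submodule ℝ (EuclideanSpace ℝ ι))
    (W' : Submodule ℝ (EuclideanSpace ℝ κ)) (M X : ν → ι → κ → ℝ)
    (hX : ∀ t j, WithLp.toLp 2 (fun i => X t i j) ∈ W)
    (hX' : ∀ t i, WithLp.toLp 2 (fun j => X t i j) ∈ W') {B : ℝ} (hB : 0 ≤ B)
    (h : ∀ (u : EuclideanSpace ℝ ι) (v : EuclideanSpace ℝ κ) (w : EuclideanSpace ℝ ν),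
      ∑ t, ∑ i, ∑ j, M t i j * u i * v j * w t ≤ B * ‖u‖ * ‖v‖ * ‖w‖) :
    ∑ t, ∑ i, ∑ j, M t i j * X t i j ≤
      B * √(Module.finrank ℝ W) * √(Module.finrank ℝ W') * √(∑ t, ∑ i, ∑ j, X t i j ^ 2) := by
  have := sum_mul_le_sqrt_finrank (κ := κ × ν) W (fun i q => M q.2 i q.1)
    (fun q => WithLp.toLp 2 fun i => X q.2 i q.1) (fun q => hX _ _)
    (B := B * √(Module.finrank ℝ W')) (by positivity)
    (fun u hu => by
      have h1 := sum_mul_le_of_bilinear_le W' (fun j t => ∑ i, M t i j * u i)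
        (fun j t => ∑ i, u i * X t i j)
        (fun t => by
          have h2 : WithLp.toLp 2 (fun j => ∑ i, u i * X t i j)
              = ∑ i, u i • (WithLp.toLp 2 (fun j => X t i j) : EuclideanSpace ℝ κ) := by
            ext j
            simp
          rw [h2]
          exact Submodule.sum_mem _ fun i _ => Submodule.smul_mem _ _ (hX' t i)) hB
        (fun v w => by
          refine le_trans (le_of_eq ?_) ((h u v w).trans (le_of_eq (by rw [hu]; ring)))
          simp_rw [Finset.sum_mul]
          rw [sum_sum_sum_rotate (fun j t i => M t i j * u i * v j * w t),
            ← sum_sum_sum_rotate (fun i j t => M t i j * u i * v j * w t),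
            sum_sum_sum_rotate (fun i j t => M t i j * u i * v j * w t)])
      have hin : ∀ t j, inner ℝ u (WithLp.toLp 2 fun i => X t i j) = ∑ i, u i * X t i j := by
        intro t j
        simp [PiLp.inner_apply, mul_comm]
      simp_rw [hin, Fintype.sum_prod_type]
      refine le_trans (le_of_eq ?_) h1
      simp_rw [Finset.sum_mul]
      rw [← sum_sum_sum_rotate (fun j t i => M t i j * u i * ∑ i, u i * X t i j)])
  refine le_trans (le_of_eq ?_) (this.trans (le_of_eq ?_))
  · simp_rw [Fintype.sum_prod_type]
    rw [← sum_sum_sum_rotate (fun i j t => M t i j * X t i j)]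
  · rw [Fintype.sum_prod_type]
    simp_rw [EuclideanSpace.norm_sq_eq, Real.norm_eq_abs, sq_abs]
    rw [sum_sum_sum_rotate (fun j t i => X t i j ^ 2),
      sum_sum_sum_rotate (fun i j t => X t i j ^ 2)]
    ring

end LowRank

/-- By Cauchy–Schwarz the right side of `h` is at most `√(β² + γ²) √(x + y)`; square and cancel `x +
y`. -/
theorem le_of_quadratic_le {α β γ x y : ℝ} (hα : 0 < α) (hx : 0 ≤ x) (hy : 0 ≤ y)
    (h : α / 2 * (x + y) ≤ β * √x + γ * √y) :
    x + y ≤ 4 / α ^ 2 * (β ^ 2 + γ ^ 2) := by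
  have hcs : (β * √x + γ * √y) ^ 2 ≤ (β ^ 2 + γ ^ 2) * (x + y) := by
    have : (β ^ 2 + γ ^ 2) * (x + y) = (β ^ 2 + γ ^ 2) * (√x ^ 2 + √y ^ 2) := by
      rw [Real.sq_sqrt hx, Real.sq_sqrt hy]
    rw [this]
    nlinarith [sq_nonneg (β * √y - γ * √x)]
  have hsq := (pow_le_pow_left₀ (by positivity) h 2).trans hcs
  rcases (add_nonneg hx hy).eq_or_lt with h0 | hpos
  · rw [← h0]; positivity
  · rw [div_mul_eq_mul_div, le_div_iff₀ (by positivity)]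
    have : ((x + y) * α ^ 2) * (x + y) ≤ (4 * (β ^ 2 + γ ^ 2)) * (x + y) := by nlinarith
    exact le_of_mul_le_mul_right this hpos

/-! ### The deterministic error bound, given norms of the noise. -/

namespace STANEParams

variable {N T RS RD K : ℕ}

theorem mem_oracleSet_self {τ₁ τ₂ : ℝ} {truth : STANEParams N T RS RD K}
    (hb : truth.Bounded τ₁ τ₂) (hc : truth.Centered) : truth ∈ oracleSet τ₁ τ₂ truth :=
  ⟨hb, hc, fun _ _ hi => not_not.1 hi⟩

theorem S_apply (p : STANEParams N T RS RD K) (i j : Fin N) :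
    p.S i j = ∑ r, p.Z i r * p.Z j r := by
  simp [S, Matrix.mul_apply]

theorem D_apply (p : STANEParams N T RS RD K) (t : Fin T) (i j : Fin N) :
    p.D t i j = ∑ r, p.U (p.g t) i r * p.v t r * p.U (p.g t) j r := by
  rw [D, Matrix.mul_apply]
  simp [V, Matrix.mul_diagonal]

theorem D_symm (p : STANEParams N T RS RD K) (t : Fin T) (i j : Fin N) :
    p.D t i j = p.D t j i := by
  simp_rw [D_apply]
  exact Finset.sum_congr rfl fun _ _ => by ring

/-- The span of the columns of `Z`, for two parameters. -/
def sharedSpan (p q : STANEParams N T RS RD K) : Submodule ℝ (EuclideanSpace ℝ (Fin N)) :=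
  Submodule.span ℝ (Set.range (Sum.elim (fun r => WithLp.toLp 2 fun i => p.Z i r)
    (fun r => WithLp.toLp 2 fun i => q.Z i r)))

/-- The span of the columns of all the `U⁽ᵏ⁾`, for two parameters. -/
def dynamicSpan (p q : STANEParams N T RS RD K) : Submodule ℝ (EuclideanSpace ℝ (Fin N)) :=
  Submodule.span ℝ (Set.range (Sum.elim
    (fun x : Fin K × Fin RD => WithLp.toLp 2 fun i => p.U x.1 i x.2)
    (fun x : Fin K × Fin RD => WithLp.toLp 2 fun i => q.U x.1 i x.2)))

theorem finrank_sharedSpan_le (p q : STANEParams N T RS RD K) :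
    (Module.finrank ℝ (sharedSpan p q) : ℝ) ≤ 2 * RS := by
  have h := finrank_range_le_card (R := ℝ) (Sum.elim
    (fun r => (WithLp.toLp 2 fun i => p.Z i r : EuclideanSpace ℝ (Fin N)))
    (fun r => WithLp.toLp 2 fun i => q.Z i r))
  simp only [Fintype.card_sum, Fintype.card_fin] at h
  have h' : Module.finrank ℝ (sharedSpan p q) ≤ RS + RS := h
  have : (Module.finrank ℝ (sharedSpan p q) : ℝ) ≤ RS + RS := by exact_mod_cast h'
  linarith

theorem finrank_dynamicSpan_le (p q : STANEParams N T RS RD K) :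
    (Module.finrank ℝ (dynamicSpan p q) : ℝ) ≤ 2 * K * RD := by
  have h := finrank_range_le_card (R := ℝ) (Sum.elim
    (fun x : Fin K × Fin RD => (WithLp.toLp 2 fun i => p.U x.1 i x.2 : EuclideanSpace ℝ (Fin N)))
    (fun x : Fin K × Fin RD => WithLp.toLp 2 fun i => q.U x.1 i x.2))
  simp only [Fintype.card_sum, Fintype.card_prod, Fintype.card_fin] at h
  have h' : Module.finrank ℝ (dynamicSpan p q) ≤ K * RD + K * RD := h
  have : (Module.finrank ℝ (dynamicSpan p q) : ℝ) ≤ K * RD + K * RD := by exact_mod_cast h'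
  linarith

theorem S_sub_S_col_mem (p q : STANEParams N T RS RD K) (j : Fin N) :
    WithLp.toLp 2 (fun i => p.S i j - q.S i j) ∈ sharedSpan p q := by
  have h : WithLp.toLp 2 (fun i => p.S i j - q.S i j)
      = ∑ r, p.Z j r • (WithLp.toLp 2 fun i => p.Z i r : EuclideanSpace ℝ (Fin N))
        - ∑ r, q.Z j r • (WithLp.toLp 2 fun i => q.Z i r : EuclideanSpace ℝ (Fin N)) := by
    ext i
    simp [S_apply, mul_comm]
  rw [h]
  refine Submodule.sub_mem _ (Submodule.sum_mem _ fun r _ => Submodule.smul_mem _ _ ?_)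
    (Submodule.sum_mem _ fun r _ => Submodule.smul_mem _ _ ?_)
  · exact Submodule.subset_span ⟨Sum.inl r, rfl⟩
  · exact Submodule.subset_span ⟨Sum.inr r, rfl⟩

/-- The labels of `p` and `q` at time `t` may differ, so the span has to contain the factors of all
groups of both; this is the source of `K ^ 2` in the rate. -/
theorem D_sub_D_col_mem (p q : STANEParams N T RS RD K) (t : Fin T) (j : Fin N) :
    WithLp.toLp 2 (fun i => p.D t i j - q.D t i j) ∈ dynamicSpan p q := by
  have h : WithLp.toLp 2 (fun i => p.D t i j - q.D t i j)
      = ∑ r, (p.v t r * p.U (p.g t) j r) •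
          (WithLp.toLp 2 fun i => p.U (p.g t) i r : EuclideanSpace ℝ (Fin N))
        - ∑ r, (q.v t r * q.U (q.g t) j r) •
          (WithLp.toLp 2 fun i => q.U (q.g t) i r : EuclideanSpace ℝ (Fin N)) := by
    ext i
    simp only [D_apply, PiLp.sub_apply, WithLp.ofLp_sum, WithLp.ofLp_smul, Finset.sum_apply,
      Pi.smul_apply, smul_eq_mul]
    congr 1 <;> exact Finset.sum_congr rfl fun _ _ => by ring
  rw [h]
  refine Submodule.sub_mem _ (Submodule.sum_mem _ fun r _ => Submodule.smul_mem _ _ ?_)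
    (Submodule.sum_mem _ fun r _ => Submodule.smul_mem _ _ ?_)
  · exact Submodule.subset_span ⟨Sum.inl (p.g t, r), rfl⟩
  · exact Submodule.subset_span ⟨Sum.inr (q.g t, r), rfl⟩

/-- The centering condition makes the shared and the time-varying differences orthogonal. -/
theorem sqDist_eq {p q : STANEParams N T RS RD K} (hp : p.Centered) (hq : q.Centered) :
    p.sqDist q = T * (∑ i, ∑ j, (p.S i j - q.S i j) ^ 2)
      + ∑ t, ∑ i, ∑ j, (p.D t i j - q.D t i j) ^ 2 := by
  have hz : ∀ p : STANEParams N T RS RD K, p.Centered → ∀ i j, ∑ t, p.D t i j = 0 := by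
    intro p hp i j
    have := congrFun (congrFun hp i) j
    simpa [Matrix.sum_apply] using this
  have hcross : ∑ t, ∑ i, ∑ j, 2 * (p.S i j - q.S i j) * (p.D t i j - q.D t i j) = 0 := by
    rw [← sum_sum_sum_rotate (fun i j t => 2 * (p.S i j - q.S i j) * (p.D t i j - q.D t i j))]
    simp_rw [← Finset.mul_sum, Finset.sum_sub_distrib, hz p hp, hz q hq]
    simp
  have hexp : p.sqDist q = ∑ t : Fin T, ∑ i, ∑ j, (p.S i j - q.S i j) ^ 2
      + ∑ t, ∑ i, ∑ j, 2 * (p.S i j - q.S i j) * (p.D t i j - q.D t i j)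
      + ∑ t, ∑ i, ∑ j, (p.D t i j - q.D t i j) ^ 2 := by
    simp_rw [sqDist, ← Finset.sum_add_distrib, Theta, Matrix.add_apply]
    exact Finset.sum_congr rfl fun _ _ => Finset.sum_congr rfl fun _ _ =>
      Finset.sum_congr rfl fun _ _ => by ring
  rw [hexp, hcross]
  simp

/-- The basic inequality of a likelihood comparison, by strong convexity. -/
theorem sqDist_le_of_negLogLik_le {τ₁ τ₂ : ℝ} {p q : STANEParams N T RS RD K}
    (hp : p.Bounded τ₁ τ₂) (hq : q.Bounded τ₁ τ₂) {A : Fin T → Matrix (Fin N) (Fin N) ℝ}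
    (h : p.negLogLik A ≤ q.negLogLik A) :
    Real.sigmoid (-τ₁) ^ 2 / 2 * p.sqDist q ≤
      ∑ t, ∑ i, ∑ j, (A t i j - Real.sigmoid (q.Theta t i j)) *
        (p.Theta t i j - q.Theta t i j) := by
  have key : ∑ t, ∑ i, ∑ j, ((A t i j * p.Theta t i j - Real.log (1 + Real.exp (p.Theta t i j)))
        + Real.sigmoid (-τ₁) ^ 2 / 2 * (p.Theta t i j - q.Theta t i j) ^ 2)
      ≤ ∑ t, ∑ i, ∑ j, ((A t i j * q.Theta t i j - Real.log (1 + Real.exp (q.Theta t i j)))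
        + (A t i j - Real.sigmoid (q.Theta t i j)) * (p.Theta t i j - q.Theta t i j)) := by
    refine Finset.sum_le_sum fun t _ => Finset.sum_le_sum fun i _ => Finset.sum_le_sum fun j _ => ?_
    have := log_one_add_exp_strong_convexity ((hq t).1 i j) ((hp t).1 i j)
    linarith
  simp_rw [Finset.sum_add_distrib] at key
  rw [negLogLik, negLogLik] at h
  simp_rw [sqDist, Finset.mul_sum]
  linarith

/-- Any candidate at least as likely as the truth is close to it, given bounds on the
trilinear form of the noise and on the bilinear form of its sum over time. -/
theorem sqDist_le_of_noise_le {τ₁ τ₂ : ℝ} {p q : STANEParams N T RS RD K}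
    (hp : p.Bounded τ₁ τ₂) (hq : q.Bounded τ₁ τ₂) (hpc : p.Centered) (hqc : q.Centered)
    {A E : Fin T → Matrix (Fin N) (Fin N) ℝ} (h : p.negLogLik A ≤ q.negLogLik A)
    (hE : ∀ t i j, E t i j = A t i j - Real.sigmoid (q.Theta t i j))
    {a b : ℝ} (ha : 0 ≤ a) (hb : 0 ≤ b)
    (htri : ∀ (u v : EuclideanSpace ℝ (Fin N)) (w : EuclideanSpace ℝ (Fin T)),
      ∑ t, ∑ i, ∑ j, E t i j * u i * v j * w t ≤ a * ‖u‖ * ‖v‖ * ‖w‖)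
    (hbi : ∀ u v : EuclideanSpace ℝ (Fin N),
      ∑ i, ∑ j, (∑ t, E t i j) * u i * v j ≤ b * √T * ‖u‖ * ‖v‖) :
    p.sqDist q ≤ 4 / Real.sigmoid (-τ₁) ^ 4 * (2 * RS * b ^ 2 + 4 * K ^ 2 * RD ^ 2 * a ^ 2) := by
  have hbasic := sqDist_le_of_negLogLik_le hp hq h
  have hdist := sqDist_eq hpc hqc
  set s := p.sqDist q with hs
  set σ := Real.sigmoid (-τ₁)
  have hσ : 0 < σ := Real.sigmoid_pos _
  set x := ∑ i, ∑ j, (p.S i j - q.S i j) ^ 2 with hx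
  set y := ∑ t, ∑ i, ∑ j, (p.D t i j - q.D t i j) ^ 2 with hy
  have hx0 : 0 ≤ x := Finset.sum_nonneg fun i _ => Finset.sum_nonneg fun j _ => sq_nonneg _
  have hy0 : 0 ≤ y := Finset.sum_nonneg fun t _ => Finset.sum_nonneg fun i _ =>
    Finset.sum_nonneg fun j _ => sq_nonneg _
  have hTx0 : 0 ≤ T * x := mul_nonneg (Nat.cast_nonneg T) hx0
  have hS := sum_mul_le_of_bilinear_le (sharedSpan p q) (fun i j => ∑ t, E t i j)
    (fun i j => p.S i j - q.S i j) (S_sub_S_col_mem p q) (by positivity) hbi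
  have hD := sum_mul_le_of_trilinear_le (dynamicSpan p q) (dynamicSpan p q) E
    (fun t i j => p.D t i j - q.D t i j) (D_sub_D_col_mem p q)
    (fun t i => by simpa only [D_symm _ _ i] using D_sub_D_col_mem p q t i) ha htri
  have hsplit : ∑ t, ∑ i, ∑ j, (A t i j - Real.sigmoid (q.Theta t i j)) *
        (p.Theta t i j - q.Theta t i j)
      = ∑ i, ∑ j, (∑ t, E t i j) * (p.S i j - q.S i j)
        + ∑ t, ∑ i, ∑ j, E t i j * (p.D t i j - q.D t i j) := by
    simp_rw [Finset.sum_mul]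
    rw [sum_sum_sum_rotate (fun i j t => E t i j * (p.S i j - q.S i j))]
    simp_rw [← Finset.sum_add_distrib, ← hE, Theta, Matrix.add_apply]
    exact Finset.sum_congr rfl fun _ _ => Finset.sum_congr rfl fun _ _ =>
      Finset.sum_congr rfl fun _ _ => by ring
  have hrS : √(Module.finrank ℝ (sharedSpan p q)) ≤ √(2 * RS) :=
    Real.sqrt_le_sqrt (finrank_sharedSpan_le p q)
  have hrD : √(Module.finrank ℝ (dynamicSpan p q)) * √(Module.finrank ℝ (dynamicSpan p q))
      ≤ 2 * K * RD := by
    rw [Real.mul_self_sqrt (Nat.cast_nonneg _)]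
    exact finrank_dynamicSpan_le p q
  have hmain : σ ^ 2 / 2 * s ≤ (b * √(2 * RS)) * √(T * x) + (a * (2 * K * RD)) * √y := by
    rw [hsplit] at hbasic
    refine hbasic.trans (add_le_add (hS.trans ?_) (hD.trans ?_))
    -- The `√T` in `hbi` joins `√x` to form `√(T * x)`, matching the weight of the shared part in
    -- `sqDist_eq`.
    · rw [Real.sqrt_mul (Nat.cast_nonneg T)]
      calc b * √T * √(Module.finrank ℝ (sharedSpan p q)) * √x
          ≤ b * √T * √(2 * RS) * √x := by gcongr
        _ = _ := by ring
    · rw [mul_assoc a]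
      exact mul_le_mul_of_nonneg_right (mul_le_mul_of_nonneg_left hrD ha) (Real.sqrt_nonneg y)
  have := le_of_quadratic_le (α := σ ^ 2) (by positivity) hTx0 hy0 (hdist ▸ hmain)
  rw [← hdist, mul_pow b, mul_pow a, Real.sq_sqrt (by positivity)] at this
  refine this.trans (le_of_eq ?_)
  ring

end STANEParams

/-! ### Concentration of the noise. -/

section Tail

/-- Independence holds only on and above the diagonal, so forms in the noise must be folded there.
The strict inequality in the inner `if` keeps diagonal terms from being counted twice. -/
theorem sum_sum_eq_sum_le_add_swap {n : ℕ} (f : Fin n → Fin n → ℝ) :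
    ∑ i, ∑ j, f i j = ∑ i, ∑ j, if i ≤ j then f i j + (if i < j then f j i else 0) else 0 := by
  have h1 : ∀ i j, f i j = (if i ≤ j then f i j else 0) + if j < i then f i j else 0 := by
    intro i j
    rcases le_or_gt i j with h | h
    · simp [h, h.not_gt]
    · simp [h, h.not_ge]
  have h2 : ∑ i, ∑ j, (if j < i then f i j else 0) = ∑ i, ∑ j, if i < j then f j i else 0 :=
    Finset.sum_comm
  calc ∑ i, ∑ j, f i j
      = ∑ i, ∑ j, (if i ≤ j then f i j else 0) + ∑ i, ∑ j, (if j < i then f i j else 0) := by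
        simp_rw [← Finset.sum_add_distrib]
        exact Finset.sum_congr rfl fun i _ => Finset.sum_congr rfl fun j _ => h1 i j
    _ = _ := by
        rw [h2]
        simp_rw [← Finset.sum_add_distrib]
        refine Finset.sum_congr rfl fun i _ => Finset.sum_congr rfl fun j _ => ?_
        rcases le_or_gt i j with h | h
        · simp [h]
        · simp [h.not_ge, h.not_gt]

/-- A sum over all entries, folded onto the entries on and above the diagonals. -/
theorem sum_eq_sum_upper {N T : ℕ} (f : Fin T → Fin N → Fin N → ℝ) :
    ∑ t, ∑ i, ∑ j, f t i j = ∑ e : {e : Fin T × Fin N × Fin N // e.2.1 ≤ e.2.2},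
      (f e.1.1 e.1.2.1 e.1.2.2 + if e.1.2.1 < e.1.2.2 then f e.1.1 e.1.2.2 e.1.2.1 else 0) := by
  simp_rw [fun t => sum_sum_eq_sum_le_add_swap (f t)]
  rw [← Finset.sum_subtype (Finset.univ.filter fun e : Fin T × Fin N × Fin N => e.2.1 ≤ e.2.2)
    (by simp) (fun e => f e.1 e.2.1 e.2.2 + if e.2.1 < e.2.2 then f e.1 e.2.2 e.2.1 else 0),
    Finset.sum_filter]
  simp_rw [Fintype.sum_prod_type]

variable {N T : ℕ} {Ω : Type*} [MeasurableSpace Ω] {μ : Measure Ω}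
  {Θ : Fin T → Matrix (Fin N) (Fin N) ℝ} {A : Ω → Fin T → Matrix (Fin N) (Fin N) ℝ}

theorem ProbabilityTheory.HasSubgaussianMGF.mono {X : Ω → ℝ} {c d : NNReal}
    (h : HasSubgaussianMGF X c μ) (hcd : c ≤ d) : HasSubgaussianMGF X d μ where
  integrable_exp_mul := h.integrable_exp_mul
  mgf_le t := (h.mgf_le t).trans <| Real.exp_le_exp.2 <| by
    have : (c : ℝ) ≤ d := hcd
    gcongr

/-- The centred adjacency tensor. -/
noncomputable def noise (μ : Measure Ω) (A : Ω → Fin T → Matrix (Fin N) (Fin N) ℝ) (ω : Ω) :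
    Fin T → Matrix (Fin N) (Fin N) ℝ :=
  fun t => Matrix.of fun i j => A ω t i j - ∫ ω, A ω t i j ∂μ

theorem noise_apply (ω : Ω) (t : Fin T) (i j : Fin N) :
    noise μ A ω t i j = A ω t i j - ∫ ω, A ω t i j ∂μ := rfl

theorem IsRandomNetwork.integral_eq (h : IsRandomNetwork μ Θ A) (t : Fin T) (i j : Fin N) :
    ∫ ω, A ω t i j ∂μ = μ.real {ω | A ω t i j = 1} := by
  have h1 : (fun ω => A ω t i j) = Set.indicator {ω | A ω t i j = 1} 1 := by
    ext ω
    rcases h.zero_or_one ω t i j with h0 | h0 <;> simp [Set.indicator, h0]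
  have hm : MeasurableSet {ω | A ω t i j = 1} := h.measurable t i j (measurableSet_singleton 1)
  rw [h1, integral_indicator_one hm]

theorem IsRandomNetwork.noise_symm (h : IsRandomNetwork μ Θ A) (ω : Ω) (t : Fin T)
    (i j : Fin N) : noise μ A ω t i j = noise μ A ω t j i := by
  simp_rw [noise_apply, h.symm _ t i j]

/-- Hoeffding's inequality for linear forms of the noise. -/
theorem IsRandomNetwork.measure_noise_ge_le [IsProbabilityMeasure μ] (h : IsRandomNetwork μ Θ A)
    (c : Fin T → Fin N → Fin N → ℝ) {v ε : ℝ} (hv : ∑ t, ∑ i, ∑ j, c t i j ^ 2 ≤ v)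
    (hε : 0 ≤ ε) :
    μ.real {ω | ε ≤ ∑ t, ∑ i, ∑ j, noise μ A ω t i j * c t i j} ≤ Real.exp (-ε ^ 2 / v) := by
  let d : {e : Fin T × Fin N × Fin N // e.2.1 ≤ e.2.2} → ℝ := fun e =>
    c e.1.1 e.1.2.1 e.1.2.2 + if e.1.2.1 < e.1.2.2 then c e.1.1 e.1.2.2 e.1.2.1 else 0
  have hv0 : 0 ≤ v := le_trans (Finset.sum_nonneg fun t _ => Finset.sum_nonneg fun i _ =>
    Finset.sum_nonneg fun j _ => sq_nonneg _) hv
  -- Folding at most doubles the sum of squares, by `(a + b)² ≤ 2 (a² + b²)`.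
  have hd : ∑ e, d e ^ 2 ≤ 2 * v := by
    refine le_trans ?_ (mul_le_mul_of_nonneg_left hv zero_le_two)
    simp_rw [Finset.mul_sum]
    rw [sum_eq_sum_upper]
    refine Finset.sum_le_sum fun e _ => ?_
    simp only [d]
    split_ifs
    · nlinarith [sq_nonneg (c e.1.1 e.1.2.1 e.1.2.2 - c e.1.1 e.1.2.2 e.1.2.1)]
    · nlinarith [sq_nonneg (c e.1.1 e.1.2.1 e.1.2.2)]
  have hsum : ∀ ω, ∑ t, ∑ i, ∑ j, noise μ A ω t i j * c t i j
      = ∑ e, d e * (A ω e.1.1 e.1.2.1 e.1.2.2 - ∫ ω, A ω e.1.1 e.1.2.1 e.1.2.2 ∂μ) := by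
    intro ω
    rw [sum_eq_sum_upper]
    refine Finset.sum_congr rfl fun e _ => ?_
    rw [h.noise_symm ω e.1.1 e.1.2.2, noise_apply]
    simp only [d]
    split_ifs <;> ring
  have hsub : ∀ e : {e : Fin T × Fin N × Fin N // e.2.1 ≤ e.2.2}, HasSubgaussianMGF
      (fun ω => d e * (A ω e.1.1 e.1.2.1 e.1.2.2 - ∫ ω, A ω e.1.1 e.1.2.1 e.1.2.2 ∂μ))
      (Real.toNNReal (d e ^ 2 / 4)) μ := fun e =>
    ((hasSubgaussianMGF_of_mem_Icc (h.measurable _ _ _).aemeasurable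
      (ae_of_all _ fun ω => by
        rcases h.zero_or_one ω e.1.1 e.1.2.1 e.1.2.2 with h0 | h0 <;>
          simp [h0]) :
        HasSubgaussianMGF _ ((‖(1 : ℝ) - 0‖₊ / 2) ^ 2) μ).const_mul (d e)).mono (by
        rw [← NNReal.coe_le_coe, Real.coe_toNNReal _ (by positivity)]
        change d e ^ 2 * (‖(1 : ℝ) - 0‖ / 2) ^ 2 ≤ d e ^ 2 / 4
        norm_num
        linarith)
  have hind := h.indep.comp (fun e x => d e * (x - ∫ ω, A ω e.1.1 e.1.2.1 e.1.2.2 ∂μ))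
    (fun e => by fun_prop)
  have hS := HasSubgaussianMGF.sum_of_iIndepFun hind (s := Finset.univ) fun e _ => hsub e
  -- An entry in `[0, 1]` has variance proxy `1/4`, so the total proxy is at most `2 v / 4`, and the
  -- exponent `-ε² / (2 (v / 2))` is `-ε² / v`.
  have hle : ∑ e, Real.toNNReal (d e ^ 2 / 4) ≤ Real.toNNReal (v / 2) := by
    rw [← Real.toNNReal_sum_of_nonneg fun e _ => by positivity, ← Finset.sum_div]
    exact Real.toNNReal_le_toNNReal (by linarith)
  have := (hS.mono hle).measure_ge_le hε
  rw [Real.coe_toNNReal _ (by positivity), mul_div_cancel₀ v two_ne_zero] at this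
  simp_rw [hsum]
  exact this

theorem IsRandomNetwork.measure_exists_noise_ge_le [IsProbabilityMeasure μ]
    (h : IsRandomNetwork μ Θ A) {α : Type*} (F : Finset α) (c : α → Fin T → Fin N → Fin N → ℝ) {v ε : ℝ}
    (hv : ∀ x ∈ F, ∑ t, ∑ i, ∑ j, c x t i j ^ 2 ≤ v) (hε : 0 ≤ ε) :
    μ.real {ω | ∃ x ∈ F, ε ≤ ∑ t, ∑ i, ∑ j, noise μ A ω t i j * c x t i j}
      ≤ F.card * Real.exp (-ε ^ 2 / v) := by
  have h1 : {ω | ∃ x ∈ F, ε ≤ ∑ t, ∑ i, ∑ j, noise μ A ω t i j * c x t i j}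
      = ⋃ x ∈ F, {ω | ε ≤ ∑ t, ∑ i, ∑ j, noise μ A ω t i j * c x t i j} := by
    ext ω; simp
  rw [h1]
  refine (measureReal_biUnion_finset_le _ _).trans ?_
  rw [← nsmul_eq_mul]
  exact Finset.sum_le_card_nsmul _ _ _ fun x hx => h.measure_noise_ge_le _ (hv x hx) hε

theorem five_pow_le_exp (n : ℕ) : (5 : ℝ) ^ n ≤ Real.exp (2 * n) := by
  have h1 : (5 : ℝ) ≤ Real.exp 2 := by
    have := Real.exp_one_gt_d9
    rw [show (2 : ℝ) = 1 + 1 by norm_num, Real.exp_add]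
    nlinarith
  rw [mul_comm, Real.exp_nat_mul]
  exact pow_le_pow_left₀ (by norm_num) h1 n

theorem EuclideanSpace.sum_sq_eq {ι : Type*} [Fintype ι] (x : EuclideanSpace ℝ ι) :
    ∑ i, x i ^ 2 = ‖x‖ ^ 2 := by
  simp [EuclideanSpace.norm_sq_eq]

/-- A union bound over at most `5 ^ (2N + T) ≤ exp (2 (2N + T))` net triples, each failing with
probability at most `exp (-3 (2N + T))`. The 8 is the cost of the three nets. -/
theorem IsRandomNetwork.measure_trilinear_le [IsProbabilityMeasure μ] (h : IsRandomNetwork μ Θ A) :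
    μ.real {ω | ¬ ∀ (u v : EuclideanSpace ℝ (Fin N)) (w : EuclideanSpace ℝ (Fin T)),
      ∑ t, ∑ i, ∑ j, noise μ A ω t i j * u i * v j * w t
        ≤ 8 * √(3 * (2 * N + T)) * ‖u‖ * ‖v‖ * ‖w‖} ≤ Real.exp (-(2 * N + T)) := by
  obtain ⟨s, hcard, hs1, hs⟩ := exists_half_net (EuclideanSpace ℝ (Fin N))
  obtain ⟨r, hcardr, hr1, hr⟩ := exists_half_net (EuclideanSpace ℝ (Fin T))
  rw [finrank_euclideanSpace, Fintype.card_fin] at hcard hcardr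
  have hbad := h.measure_exists_noise_ge_le (s ×ˢ s ×ˢ r)
    (fun x t i j => x.1 i * x.2.1 j * x.2.2 t) (v := 1) (ε := √(3 * (2 * N + T)))
    (fun x hx => by
      simp only [Finset.mem_product] at hx
      simp_rw [mul_pow, ← Finset.sum_mul, ← Finset.mul_sum, ← Finset.sum_mul,
        EuclideanSpace.sum_sq_eq]
      have := hs1 _ hx.1
      have := hs1 _ hx.2.1
      have := hr1 _ hx.2.2
      simp_rw [← mul_pow]
      exact pow_le_one₀ (by positivity) (mul_le_one₀ (mul_le_one₀ ‹_› (norm_nonneg _) ‹_›)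
        (norm_nonneg _) ‹_›))
    (Real.sqrt_nonneg _)
  refine (measureReal_mono ?_).trans (hbad.trans ?_)
  · intro ω hω
    by_contra hcon
    simp only [Set.mem_ofPred_eq, not_exists, not_and, not_le, Finset.mem_product] at hcon
    refine hω (IsHalfNet.trilinear_le hs hs hr fun x hx y hy w hw => ?_)
    refine le_trans (le_of_eq ?_) (hcon (x, y, w) ⟨hx, hy, hw⟩).le
    exact Finset.sum_congr rfl fun _ _ => Finset.sum_congr rfl fun _ _ =>
      Finset.sum_congr rfl fun _ _ => by ring
  · have hc : ((s ×ˢ s ×ˢ r).card : ℝ) ≤ Real.exp (2 * (2 * N + T)) := by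
      have h1 : (s ×ˢ s ×ˢ r).card ≤ 5 ^ (2 * N + T) := by
        rw [Finset.card_product, Finset.card_product]
        calc s.card * (s.card * r.card) ≤ 5 ^ N * (5 ^ N * 5 ^ T) := by gcongr
          _ = _ := by ring
      have h2 := five_pow_le_exp (2 * N + T)
      push_cast at h2
      exact le_trans (by exact_mod_cast h1) h2
    calc _ ≤ Real.exp (2 * (2 * N + T)) * Real.exp (-√(3 * (2 * N + T)) ^ 2 / 1) := by gcongr
      _ = _ := by
        rw [← Real.exp_add, Real.sq_sqrt (by positivity)]
        congr 1
        ring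

/-- The coefficients `x i * y j` repeat at every time, so their squares sum to at most `T`. With `ε²
= 5 N T` each net pair fails with probability at most `exp (-5 N)`, against at most `exp (4 N)`
pairs. -/
theorem IsRandomNetwork.measure_bilinear_le [IsProbabilityMeasure μ] (h : IsRandomNetwork μ Θ A) (hT : 0 < T) :
    μ.real {ω | ¬ ∀ u v : EuclideanSpace ℝ (Fin N),
      ∑ i, ∑ j, (∑ t, noise μ A ω t i j) * u i * v j
        ≤ 4 * √(5 * N * T) * ‖u‖ * ‖v‖} ≤ Real.exp (-N) := by
  obtain ⟨s, hcard, hs1, hs⟩ := exists_half_net (EuclideanSpace ℝ (Fin N))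
  rw [finrank_euclideanSpace, Fintype.card_fin] at hcard
  have hT' : (0 : ℝ) < T := by exact_mod_cast hT
  have hbad := h.measure_exists_noise_ge_le (s ×ˢ s)
    (fun x t i j => x.1 i * x.2 j) (v := T) (ε := √(5 * N * T))
    (fun x hx => by
      simp only [Finset.mem_product] at hx
      simp_rw [mul_pow, ← Finset.mul_sum, ← Finset.sum_mul, EuclideanSpace.sum_sq_eq]
      have := hs1 _ hx.1
      have := hs1 _ hx.2
      rw [Finset.sum_const, Finset.card_univ, Fintype.card_fin, nsmul_eq_mul, mul_assoc,
        ← mul_pow]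
      exact mul_le_of_le_one_right hT'.le
        (pow_le_one₀ (by positivity) (mul_le_one₀ ‹_› (norm_nonneg _) ‹_›)))
    (Real.sqrt_nonneg _)
  refine (measureReal_mono ?_).trans (hbad.trans ?_)
  · intro ω hω
    by_contra hcon
    simp only [Set.mem_ofPred_eq, not_exists, not_and, not_le, Finset.mem_product] at hcon
    refine hω (IsHalfNet.bilinear_le hs hs fun x hx y hy => ?_)
    refine le_trans (le_of_eq ?_) (hcon (x, y) ⟨hx, hy⟩).le
    simp_rw [Finset.sum_mul]
    rw [sum_sum_sum_rotate (fun i j t => noise μ A ω t i j * x i * y j)]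
    exact Finset.sum_congr rfl fun _ _ => Finset.sum_congr rfl fun _ _ =>
      Finset.sum_congr rfl fun _ _ => by ring
  · have hc : ((s ×ˢ s).card : ℝ) ≤ Real.exp (2 * (2 * N)) := by
      have h1 : (s ×ˢ s).card ≤ 5 ^ (2 * N) := by
        rw [Finset.card_product]
        calc s.card * s.card ≤ 5 ^ N * 5 ^ N := by gcongr
          _ = _ := by ring
      have h2 := five_pow_le_exp (2 * N)
      push_cast at h2
      exact le_trans (by exact_mod_cast h1) h2
    calc _ ≤ Real.exp (2 * (2 * N)) * Real.exp (-√(5 * N * T) ^ 2 / T) := by gcongr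
      _ = _ := by
        rw [← Real.exp_add, Real.sq_sqrt (by positivity)]
        congr 1
        field_simp
        ring

end Tail

/-! ### The diagonal bias. -/

section Diagonal

theorem sum_diagonal_mul_le {ι : Type*} [Fintype ι] {M : ι → ι → ℝ} {D : ℝ}
    (hoff : ∀ i j, i ≠ j → M i j = 0) (hdiag : ∀ i, |M i i| ≤ D)
    (u v : EuclideanSpace ℝ ι) : ∑ i, ∑ j, M i j * u i * v j ≤ D * ‖u‖ * ‖v‖ := by
  rcases isEmpty_or_nonempty ι with hι | ⟨⟨i₀⟩⟩
  · simp [EuclideanSpace.norm_eq]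
  have hD : 0 ≤ D := (abs_nonneg _).trans (hdiag i₀)
  have h1 : ∀ i, ∑ j, M i j * u i * v j = M i i * u i * v i := fun i =>
    Finset.sum_eq_single i (fun j _ hj => by rw [hoff i j hj.symm]; ring) (by simp)
  simp_rw [h1]
  calc ∑ i, M i i * u i * v i ≤ ∑ i, D * (|u i| * |v i|) := by
        refine Finset.sum_le_sum fun i _ => ?_
        refine (le_abs_self _).trans ?_
        rw [abs_mul, abs_mul, mul_assoc]
        exact mul_le_mul_of_nonneg_right (hdiag i) (by positivity)
    _ = D * ∑ i, |u i| * |v i| := by rw [Finset.mul_sum]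
    _ ≤ D * (‖u‖ * ‖v‖) := by
        refine mul_le_mul_of_nonneg_left ?_ hD
        have := Real.sum_mul_le_sqrt_mul_sqrt Finset.univ (fun i => |u i|) (fun i => |v i|)
        simpa [EuclideanSpace.norm_eq] using this
    _ = _ := by ring

theorem sum_abs_le_sqrt_card_mul_norm {T : ℕ} (w : EuclideanSpace ℝ (Fin T)) :
    ∑ t, |w t| ≤ √T * ‖w‖ := by
  have := Real.sum_mul_le_sqrt_mul_sqrt Finset.univ (fun _ : Fin T => (1 : ℝ)) (fun t => |w t|)
  simpa [EuclideanSpace.norm_eq] using this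

/-- Contracting time first leaves a diagonal matrix with entries at most `D * ∑ |w t| ≤ D * √T *
‖w‖`. -/
theorem trilinear_diagonal_le {N T : ℕ} {β : Fin T → Matrix (Fin N) (Fin N) ℝ} {D : ℝ}
    (hD : 0 ≤ D) (hoff : ∀ t i j, i ≠ j → β t i j = 0) (hdiag : ∀ t i, |β t i i| ≤ D)
    (u v : EuclideanSpace ℝ (Fin N)) (w : EuclideanSpace ℝ (Fin T)) :
    ∑ t, ∑ i, ∑ j, β t i j * u i * v j * w t ≤ D * √T * ‖u‖ * ‖v‖ * ‖w‖ := by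
  have h1 := sum_diagonal_mul_le (M := fun i j => ∑ t, β t i j * w t) (D := D * (√T * ‖w‖))
    (fun i j hij => Finset.sum_eq_zero fun t _ => by rw [hoff t i j hij, zero_mul])
    (fun i => by
      calc |∑ t, β t i i * w t| ≤ ∑ t, |β t i i * w t| := Finset.abs_sum_le_sum_abs _ _
        _ ≤ ∑ t, D * |w t| := Finset.sum_le_sum fun t _ => by
            rw [abs_mul]
            exact mul_le_mul_of_nonneg_right (hdiag t i) (abs_nonneg _)
        _ ≤ D * (√T * ‖w‖) := by
            rw [← Finset.mul_sum]
            exact mul_le_mul_of_nonneg_left (sum_abs_le_sqrt_card_mul_norm w) hD) u v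
  refine le_trans (le_of_eq ?_) (h1.trans (le_of_eq (by ring)))
  simp_rw [Finset.sum_mul]
  rw [sum_sum_sum_rotate (fun i j t => β t i j * w t * u i * v j)]
  exact Finset.sum_congr rfl fun _ _ => Finset.sum_congr rfl fun _ _ =>
    Finset.sum_congr rfl fun _ _ => by ring

theorem bilinear_diagonal_le {N T : ℕ} {β : Fin T → Matrix (Fin N) (Fin N) ℝ} {D : ℝ}
    (hoff : ∀ t i j, i ≠ j → β t i j = 0) (hdiag : ∀ t i, |β t i i| ≤ D)
    (u v : EuclideanSpace ℝ (Fin N)) :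
    ∑ i, ∑ j, (∑ t, β t i j) * u i * v j ≤ D * T * ‖u‖ * ‖v‖ :=
  sum_diagonal_mul_le (fun i j hij => Finset.sum_eq_zero fun t _ => hoff t i j hij)
    (fun i => (Finset.abs_sum_le_sum_abs _ _).trans
      ((Finset.sum_le_sum fun t _ => hdiag t i).trans (by simp [mul_comm]))) u v

end Diagonal

/-! ### Assembling the random and the deterministic bounds. -/

section Oracle

variable {N T RS RD K : ℕ} {Ω : Type*} [MeasurableSpace Ω] {μ : Measure Ω}
  {A : Ω → Fin T → Matrix (Fin N) (Fin N) ℝ}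

open STANEParams

/-- The forms of the noise are bounded simultaneously, with high probability. -/
theorem IsRandomNetwork.measure_noise_bounds_ge [IsProbabilityMeasure μ]
    {Θ : Fin T → Matrix (Fin N) (Fin N) ℝ} (h : IsRandomNetwork μ Θ A) (hT : 0 < T) :
    1 - T * Real.exp (-N) - Real.exp (-(2 * N + T)) ≤
      μ.real {ω | (∀ (u v : EuclideanSpace ℝ (Fin N)) (w : EuclideanSpace ℝ (Fin T)),
        ∑ t, ∑ i, ∑ j, noise μ A ω t i j * u i * v j * w t
          ≤ 8 * √(3 * (2 * N + T)) * ‖u‖ * ‖v‖ * ‖w‖) ∧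
        ∀ u v : EuclideanSpace ℝ (Fin N), ∑ i, ∑ j, (∑ t, noise μ A ω t i j) * u i * v j
          ≤ 4 * √(5 * N * T) * ‖u‖ * ‖v‖} := by
  set G := {ω | (∀ (u v : EuclideanSpace ℝ (Fin N)) (w : EuclideanSpace ℝ (Fin T)),
        ∑ t, ∑ i, ∑ j, noise μ A ω t i j * u i * v j * w t
          ≤ 8 * √(3 * (2 * N + T)) * ‖u‖ * ‖v‖ * ‖w‖) ∧
        ∀ u v : EuclideanSpace ℝ (Fin N), ∑ i, ∑ j, (∑ t, noise μ A ω t i j) * u i * v j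
          ≤ 4 * √(5 * N * T) * ‖u‖ * ‖v‖} with hG
  set B₁ := {ω | ¬ ∀ (u v : EuclideanSpace ℝ (Fin N)) (w : EuclideanSpace ℝ (Fin T)),
        ∑ t, ∑ i, ∑ j, noise μ A ω t i j * u i * v j * w t
          ≤ 8 * √(3 * (2 * N + T)) * ‖u‖ * ‖v‖ * ‖w‖}
  set B₂ := {ω | ¬ ∀ u v : EuclideanSpace ℝ (Fin N),
        ∑ i, ∑ j, (∑ t, noise μ A ω t i j) * u i * v j ≤ 4 * √(5 * N * T) * ‖u‖ * ‖v‖}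
  have h1 : μ.real B₁ ≤ _ := h.measure_trilinear_le
  have h2 : μ.real B₂ ≤ _ := h.measure_bilinear_le hT
  -- Subadditivity over a cover avoids proving that these events, defined by uncountably many
  -- vectors, are measurable.
  have hcover : (Set.univ : Set Ω) = G ∪ (B₁ ∪ B₂) := by
    refine (Set.eq_univ_of_forall fun ω => ?_).symm
    by_cases hB₁ : ω ∈ B₁
    · exact Or.inr (Or.inl hB₁)
    by_cases hB₂ : ω ∈ B₂
    · exact Or.inr (Or.inr hB₂)
    exact Or.inl ⟨not_not.1 hB₁, not_not.1 hB₂⟩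
  have h3 : (1 : ℝ) ≤ μ.real G + (μ.real B₁ + μ.real B₂) := by
    rw [← probReal_univ (μ := μ), hcover]
    exact (measureReal_union_le _ _).trans (add_le_add_right (measureReal_union_le _ _) _)
  have h4 : Real.exp (-N) ≤ T * Real.exp (-N) :=
    le_mul_of_one_le_left (Real.exp_pos _).le (by exact_mod_cast hT)
  linarith

/-- High-probability error bound for the oracle estimators, when the bias `𝔼 A - P` of the
network is confined to the diagonals and bounded there by `D`. -/
theorem IsRandomNetwork.measure_sqDist_le_ge [IsProbabilityMeasure μ] {τ₁ τ₂ : ℝ}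
    {truth : STANEParams N T RS RD K} (hb : truth.Bounded τ₁ τ₂) (hc : truth.Centered)
    (h : IsRandomNetwork μ truth.Theta A) {D : ℝ} (hD : 0 ≤ D)
    (hdiag : ∀ t i, |∫ ω, A ω t i i ∂μ - Real.sigmoid (truth.Theta t i i)| ≤ D) :
    1 - T * Real.exp (-N) - Real.exp (-(2 * N + T)) ≤
      μ.real {ω | ∀ est : STANEParams N T RS RD K, IsOracleEstimator τ₁ τ₂ truth (A ω) est →
        est.sqDist truth ≤ 4 / Real.sigmoid (-τ₁) ^ 4 *
          (2 * RS * (4 * √(5 * N) + D * √T) ^ 2 +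
            4 * K ^ 2 * RD ^ 2 * (8 * √(3 * (2 * N + T)) + D * √T) ^ 2)} := by
  -- For `T = 0` the term `T * exp (-N)` cannot absorb `exp (-N)`, but then the distance is an empty
  -- sum.
  rcases Nat.eq_zero_or_pos T with rfl | hT
  · have huniv : {ω | ∀ est : STANEParams N 0 RS RD K,
        IsOracleEstimator τ₁ τ₂ truth (A ω) est →
        est.sqDist truth ≤ 4 / Real.sigmoid (-τ₁) ^ 4 *
          (2 * RS * (4 * √(5 * N) + D * √(0 : ℕ)) ^ 2 +
            4 * K ^ 2 * RD ^ 2 * (8 * √(3 * (2 * N + (0 : ℕ))) + D * √(0 : ℕ)) ^ 2)}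
        = Set.univ := by
      refine Set.eq_univ_of_forall fun ω est _ => ?_
      rw [sqDist, Finset.univ_eq_empty, Finset.sum_empty]
      positivity
    rw [huniv, probReal_univ]
    have := Real.exp_pos (-(2 * (N : ℝ) + (0 : ℕ)))
    push_cast at this ⊢
    linarith
  refine (h.measure_noise_bounds_ge hT).trans (measureReal_mono ?_)
  rintro ω ⟨h3, h2⟩ est ⟨hmem, hmin⟩
  let β : Fin T → Matrix (Fin N) (Fin N) ℝ := fun t => Matrix.of fun i j =>
    ∫ ω, A ω t i j ∂μ - Real.sigmoid (truth.Theta t i j)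
  have hoff : ∀ t i j, i ≠ j → β t i j = 0 := fun t i j hij => by
    simp only [β, Matrix.of_apply]
    rw [h.integral_eq, h.bernoulli t i j hij, sub_self]
  refine sqDist_le_of_noise_le hmem.1 hb hmem.2.1 hc
    (isMinOn_iff.1 hmin _ (mem_oracleSet_self hb hc)) (E := fun t => noise μ A ω t + β t)
    (fun t i j => ?_) (by positivity) (by positivity) (fun u v w => ?_) (fun u v => ?_)
  · simp only [β, Matrix.add_apply, Matrix.of_apply, noise_apply]
    ring
  · have h1 := add_le_add (h3 u v w) (trilinear_diagonal_le hD hoff hdiag u v w)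
    refine le_trans (le_of_eq ?_) (h1.trans (le_of_eq (by ring)))
    simp_rw [← Finset.sum_add_distrib, Matrix.add_apply]
    exact Finset.sum_congr rfl fun _ _ => Finset.sum_congr rfl fun _ _ =>
      Finset.sum_congr rfl fun _ _ => by ring
  · have h1 := add_le_add (h2 u v) (bilinear_diagonal_le hoff hdiag u v)
    refine le_trans (le_of_eq ?_) (h1.trans (le_of_eq ?_))
    · simp_rw [← Finset.sum_add_distrib, Matrix.add_apply]
      exact Finset.sum_congr rfl fun _ _ => Finset.sum_congr rfl fun _ _ => by
        rw [Finset.sum_add_distrib]; ring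
    -- Both summands are brought to the form `b * √T`, giving `b = 4 √(5 N) + D √T`.
    · rw [Real.sqrt_mul (by positivity),
        show D * (T : ℝ) = D * (√T * √T) by rw [Real.mul_self_sqrt (Nat.cast_nonneg T)]]
      ring

end Oracle

theorem theorem1 :
    ∃ c₁ c₂ : ℝ, 0 < c₁ ∧ 0 < c₂ ∧
      ∀ τ₁ : ℝ, 0 < τ₁ → ∃ C₁ C₂ : ℝ, 0 < C₁ ∧ 0 < C₂ ∧
        ∀ (τ₂ : ℝ), 0 < τ₂ → ∀ (N T RS RD K : ℕ) (truth : STANEParams N T RS RD K),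
          truth.Bounded τ₁ τ₂ → truth.Centered →
          ∀ (Ω : Type*) [MeasurableSpace Ω] (μ : Measure Ω) [IsProbabilityMeasure μ]
            (A : Ω → Fin T → Matrix (Fin N) (Fin N) ℝ),
            IsRandomNetwork μ truth.Theta A →
            (BernoulliLoops μ truth.Theta A →
              1 - T * Real.exp (-c₁ * N) - Real.exp (-c₂ * (2 * N + T)) ≤
                μ.real {ω | ∀ est : STANEParams N T RS RD K,
                  STANEParams.IsOracleEstimator τ₁ τ₂ truth (A ω) est →
                    est.sqDist truth ≤
                      C₁ * N * RS + C₂ * K ^ 2 * RD ^ 2 * (2 * N + T)}) ∧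
            (NoLoops A →
              1 - T * Real.exp (-c₁ * N) - Real.exp (-c₂ * (2 * N + T)) ≤
                μ.real {ω | ∀ est : STANEParams N T RS RD K,
                  STANEParams.IsOracleEstimator τ₁ τ₂ truth (A ω) est →
                    est.sqDist truth ≤
                      C₁ * (N + T) * RS + C₂ * K ^ 2 * RD ^ 2 * (2 * N + T)}) := by
  refine ⟨1, 1, one_pos, one_pos, fun τ₁ _ => ?_⟩
  have hσ : 0 < Real.sigmoid (-τ₁) := Real.sigmoid_pos _
  -- `1280 = 4 * 2 * 160` and `6176 = 4 * 4 * 386`. By `(x + y)² ≤ 2 x² + 2 y²`, the squares without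
  -- loops are at most `160 N + 2 T ≤ 160 (N + T)` and `384 (2N + T) + 2 T ≤ 386 (2N + T)`; with
  -- Bernoulli loops they are smaller.
  refine ⟨1280 / Real.sigmoid (-τ₁) ^ 4, 6176 / Real.sigmoid (-τ₁) ^ 4, by positivity,
    by positivity, fun τ₂ _ N T RS RD K truth hb hc Ω _ μ _ A h => ?_⟩
  have hN : √(5 * N : ℝ) ^ 2 = 5 * N := Real.sq_sqrt (by positivity)
  have hNT : √(3 * (2 * N + T) : ℝ) ^ 2 = 3 * (2 * N + T) := Real.sq_sqrt (by positivity)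
  have hT : √(T : ℝ) ^ 2 = T := Real.sq_sqrt (by positivity)
  have hN0 : (0 : ℝ) ≤ N := Nat.cast_nonneg N
  have hT0 : (0 : ℝ) ≤ T := Nat.cast_nonneg T
  have hcomb : ∀ {x y X Y : ℝ}, x ≤ 160 * X → y ≤ 386 * Y →
      4 / Real.sigmoid (-τ₁) ^ 4 * (2 * RS * x + 4 * K ^ 2 * RD ^ 2 * y) ≤
        1280 / Real.sigmoid (-τ₁) ^ 4 * X * RS +
          6176 / Real.sigmoid (-τ₁) ^ 4 * K ^ 2 * RD ^ 2 * Y := by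
    intro x y X Y hx hy
    calc _ ≤ 4 / Real.sigmoid (-τ₁) ^ 4 *
          (2 * RS * (160 * X) + 4 * K ^ 2 * RD ^ 2 * (386 * Y)) := by gcongr
      _ = _ := by ring
  simp only [neg_mul, one_mul]
  constructor
  · intro hloops
    refine (h.measure_sqDist_le_ge hb hc le_rfl fun t i => ?_).trans
      (measureReal_mono fun ω hω est hest => (hω est hest).trans (hcomb ?_ ?_))
    · rw [h.integral_eq, hloops t i, sub_self, abs_zero]
    · linarith
    · linarith
  · intro hno
    -- Here `D = 1`: the diagonal mean is 0, while the model value is a sigmoid in `[0, 1]`.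
    refine (h.measure_sqDist_le_ge hb hc zero_le_one fun t i => ?_).trans
      (measureReal_mono fun ω hω est hest => (hω est hest).trans (hcomb ?_ ?_))
    · have hz : ∫ ω, A ω t i i ∂μ = 0 := by simp [hno _ t i]
      rw [hz, zero_sub, abs_neg, abs_of_nonneg (Real.sigmoid_nonneg _)]
      exact Real.sigmoid_le_one _
    · linarith [sq_nonneg (4 * √(5 * N : ℝ) - √(T : ℝ))]
    · linarith [sq_nonneg (8 * √(3 * (2 * N + T) : ℝ) - √(T : ℝ))]
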